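/- Work in the language of second-order arithmetic, with number variables, set variables, $0,1,+,\cdot,<,=$ and $\in$. The system $\mathbf{RCA}_0$ consists of the usual basic axioms for $0,1,+,\cdot,<$, of $\Sigma^0_1$-induction and of $\Delta^0_1$-comprehension (both schemes with number and set parameters). As usual, a binary relation on $\mathbb N$ is coded by the set of codes $(m+n)^2+m$ of its pairs $(m,n)$. A (countable) linear order $X$ is a set coding a relation $\leq_X$ that is antisymmetric, transitive and total on its field $\{n : n\leq_X n\}$, where $m\leq_X n$ implies that $m$ and $n$ lie in the field. We write $m<_X n$ for $m\leq_X n$ and $m\neq n$. A linear order $X$ is a *well order* if there is no function $f:\mathbb N\to X$ with $f(n+1)<_X f(n)$ for all $n$. An *initial segment* of $X$ is a set $I\subseteq X$ such that $x<_X y$ and $y\in I$ imply $x\in I$. A linear order $X$ is a *weak well order* if there are no initial segments $I_0\subsetneq I$ of $X$ with an embedding $f:I\to I_0$, i.e. a function such that $x<_X y$ implies $f(x)<_X f(y)$. **Corollary.** Over $\mathbf{RCA}_0$, the statement that every weak well order is a well order implies arithmetical comprehension. That is, each instance $$\exists X\,\forall n\,(n\in X\leftrightarrow\varphi(n)),$$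 where $\varphi$ is a formula without set quantifiers, possibly with number and set parameters other than $X$, is a logical consequence of the axioms of $\mathbf{RCA}_0$ together with the sentence "every weak well order is a well order". In other words, the universal closure of each instance is true in every structure for the two-sorted language (with arbitrary, possibly nonstandard, first-order part, and with an arbitrary collection of subsets as range of the set variables) in which $\mathbf{RCA}_0$ and this sentence are true. -/

import Mathlib

/-!
Second-order arithmetic: the two-sorted language with number and set variables, its structures and
satisfaction relation, the axioms of `RCA₀`, the arithmetical comprehension scheme, and the
formalization of countable linear orders, well orders and weak well orders in this language.
-/

universe u

namespace SOA

/-! ### The language -/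

/-- Numerical terms in `n` free number variables. -/
inductive Term (n : ℕ) : Type
  | var (i : Fin n) : Term n
  | zero : Term n
  | one : Term n
  | add (s t : Term n) : Term n
  | mul (s t : Term n) : Term n

instance (n : ℕ) : Zero (Term n) := ⟨Term.zero⟩
instance (n : ℕ) : One (Term n) := ⟨Term.one⟩
instance (n : ℕ) : Add (Term n) := ⟨Term.add⟩
instance (n : ℕ) : Mul (Term n) := ⟨Term.mul⟩

/-- Formulas with `n` free number variables and `k` free set variables.  A quantifier binds the
variable with index `0` of its sort; the indices of the other variables of that sort go up by one
below the quantifier. -/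
inductive Formula : ℕ → ℕ → Type
  | eq {n k : ℕ} (s t : Term n) : Formula n k
  | lt {n k : ℕ} (s t : Term n) : Formula n k
  | mem {n k : ℕ} (t : Term n) (X : Fin k) : Formula n k
  | not {n k : ℕ} (φ : Formula n k) : Formula n k
  | and {n k : ℕ} (φ ψ : Formula n k) : Formula n k
  | or {n k : ℕ} (φ ψ : Formula n k) : Formula n k
  | imp {n k : ℕ} (φ ψ : Formula n k) : Formula n k
  | all {n k : ℕ} (φ : Formula (n + 1) k) : Formula n k
  | ex {n k : ℕ} (φ : Formula (n + 1) k) : Formula n k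
  | allSet {n k : ℕ} (φ : Formula n (k + 1)) : Formula n k
  | exSet {n k : ℕ} (φ : Formula n (k + 1)) : Formula n k

/-- Formulas without free variables. -/
abbrev Sentence : Type := Formula 0 0

/-- Simultaneous substitution of terms for number variables. -/
def Term.subst {n m : ℕ} (σ : Fin n → Term m) : Term n → Term m
  | .var i => σ i
  | .zero => .zero
  | .one => .one
  | .add s t => .add (s.subst σ) (t.subst σ)
  | .mul s t => .mul (s.subst σ) (t.subst σ)

/-- A term, read below one more number quantifier. -/
def Term.lift {n : ℕ} (t : Term n) : Term (n + 1) := t.subst fun i => .var i.succ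

/-- Simultaneous capture-avoiding substitution of terms for number variables and of set variables
for set variables. -/
def Formula.subst : {n m k l : ℕ} → (Fin n → Term m) → (Fin k → Fin l) → Formula n k → Formula m l
  | _, _, _, _, σ, _, .eq s t => .eq (s.subst σ) (t.subst σ)
  | _, _, _, _, σ, _, .lt s t => .lt (s.subst σ) (t.subst σ)
  | _, _, _, _, σ, ρ, .mem t X => .mem (t.subst σ) (ρ X)
  | _, _, _, _, σ, ρ, .not φ => .not (φ.subst σ ρ)
  | _, _, _, _, σ, ρ, .and φ ψ => .and (φ.subst σ ρ) (ψ.subst σ ρ)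
  | _, _, _, _, σ, ρ, .or φ ψ => .or (φ.subst σ ρ) (ψ.subst σ ρ)
  | _, _, _, _, σ, ρ, .imp φ ψ => .imp (φ.subst σ ρ) (ψ.subst σ ρ)
  | _, m, _, _, σ, ρ, .all φ =>
      .all (φ.subst (Fin.cons (.var 0 : Term (m + 1)) fun i => (σ i).lift) ρ)
  | _, m, _, _, σ, ρ, .ex φ =>
      .ex (φ.subst (Fin.cons (.var 0 : Term (m + 1)) fun i => (σ i).lift) ρ)
  | _, _, _, l, σ, ρ, .allSet φ =>
      .allSet (φ.subst σ (Fin.cons (0 : Fin (l + 1)) fun i => (ρ i).succ))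
  | _, _, _, l, σ, ρ, .exSet φ =>
      .exSet (φ.subst σ (Fin.cons (0 : Fin (l + 1)) fun i => (ρ i).succ))

namespace Formula

/-- Biconditional. -/
def iff {n k : ℕ} (φ ψ : Formula n k) : Formula n k := (φ.imp ψ).and (ψ.imp φ)

/-- The bounded quantifier `∀ x < t`, where `x` does not occur in `t`. -/
def ball {n k : ℕ} (t : Term n) (φ : Formula (n + 1) k) : Formula n k :=
  .all ((lt (.var 0) t.lift).imp φ)

/-- The bounded quantifier `∃ x < t`, where `x` does not occur in `t`. -/
def bex {n k : ℕ} (t : Term n) (φ : Formula (n + 1) k) : Formula n k :=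
  .ex ((lt (.var 0) t.lift).and φ)

/-- Universal quantification over all free number variables. -/
def closeNum : {n k : ℕ} → Formula n k → Formula 0 k
  | 0, _, φ => φ
  | _ + 1, _, φ => closeNum (.all φ)

/-- Universal quantification over all free set variables. -/
def closeSet : {n k : ℕ} → Formula n k → Formula n 0
  | _, 0, φ => φ
  | _, _ + 1, φ => closeSet (.allSet φ)

/-- The universal closure. -/
def close {n k : ℕ} (φ : Formula n k) : Sentence := φ.closeNum.closeSet

/-! ### Classes of formulas (number and set parameters are allowed) -/

/-- `Σ⁰₀` formulas: all quantifiers are bounded number quantifiers. -/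
inductive IsSigma00 : {n k : ℕ} → Formula n k → Prop
  | eq {n k : ℕ} (s t : Term n) : IsSigma00 (.eq s t : Formula n k)
  | lt {n k : ℕ} (s t : Term n) : IsSigma00 (.lt s t : Formula n k)
  | mem {n k : ℕ} (t : Term n) (X : Fin k) : IsSigma00 (.mem t X)
  | not {n k : ℕ} {φ : Formula n k} : IsSigma00 φ → IsSigma00 φ.not
  | and {n k : ℕ} {φ ψ : Formula n k} : IsSigma00 φ → IsSigma00 ψ → IsSigma00 (φ.and ψ)
  | or {n k : ℕ} {φ ψ : Formula n k} : IsSigma00 φ → IsSigma00 ψ → IsSigma00 (φ.or ψ)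
  | imp {n k : ℕ} {φ ψ : Formula n k} : IsSigma00 φ → IsSigma00 ψ → IsSigma00 (φ.imp ψ)
  | ball {n k : ℕ} (t : Term n) {φ : Formula (n + 1) k} : IsSigma00 φ → IsSigma00 (φ.ball t)
  | bex {n k : ℕ} (t : Term n) {φ : Formula (n + 1) k} : IsSigma00 φ → IsSigma00 (φ.bex t)

/-- `Σ⁰₁` formulas `∃ m θ` with `θ` in `Σ⁰₀`. -/
def IsSigma01 {n k : ℕ} (φ : Formula n k) : Prop :=
  ∃ θ : Formula (n + 1) k, θ.IsSigma00 ∧ φ = .ex θ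

/-- `Π⁰₁` formulas `∀ m θ` with `θ` in `Σ⁰₀`. -/
def IsPi01 {n k : ℕ} (φ : Formula n k) : Prop :=
  ∃ θ : Formula (n + 1) k, θ.IsSigma00 ∧ φ = .all θ

/-- Arithmetical formulas: no set quantifiers. -/
inductive IsArithmetical : {n k : ℕ} → Formula n k → Prop
  | eq {n k : ℕ} (s t : Term n) : IsArithmetical (.eq s t : Formula n k)
  | lt {n k : ℕ} (s t : Term n) : IsArithmetical (.lt s t : Formula n k)
  | mem {n k : ℕ} (t : Term n) (X : Fin k) : IsArithmetical (.mem t X)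
  | not {n k : ℕ} {φ : Formula n k} : IsArithmetical φ → IsArithmetical φ.not
  | and {n k : ℕ} {φ ψ : Formula n k} :
      IsArithmetical φ → IsArithmetical ψ → IsArithmetical (φ.and ψ)
  | or {n k : ℕ} {φ ψ : Formula n k} :
      IsArithmetical φ → IsArithmetical ψ → IsArithmetical (φ.or ψ)
  | imp {n k : ℕ} {φ ψ : Formula n k} :
      IsArithmetical φ → IsArithmetical ψ → IsArithmetical (φ.imp ψ)
  | all {n k : ℕ} {φ : Formula (n + 1) k} : IsArithmetical φ → IsArithmetical φ.all
  | ex {n k : ℕ} {φ : Formula (n + 1) k} : IsArithmetical φ → IsArithmetical φ.ex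

end Formula

/-! ### Structures and logical consequence -/

/-- Structures for the language: an arbitrary first-order part (not necessarily the standard
natural numbers), and a collection of subsets of it over which the set variables range. -/
structure Model : Type (u + 1) where
  carrier : Type u
  zero : carrier
  one : carrier
  add : carrier → carrier → carrier
  mul : carrier → carrier → carrier
  lt : carrier → carrier → Prop
  sets : Set (Set carrier)

/-- The value of a term. -/
def Model.val (M : Model.{u}) {n : ℕ} (v : Fin n → M.carrier) : Term n → M.carrier
  | .var i => v i
  | .zero => M.zero
  | .one => M.one
  | .add s t => M.add (M.val v s) (M.val v t)
  | .mul s t => M.mul (M.val v s) (M.val v t)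

/-- Satisfaction of a formula under an assignment of its free variables. -/
def Model.Sat (M : Model.{u}) :
    {n k : ℕ} → (Fin n → M.carrier) → (Fin k → Set M.carrier) → Formula n k → Prop
  | _, _, v, _, .eq s t => M.val v s = M.val v t
  | _, _, v, _, .lt s t => M.lt (M.val v s) (M.val v t)
  | _, _, v, V, .mem t X => M.val v t ∈ V X
  | _, _, v, V, .not φ => ¬ M.Sat v V φ
  | _, _, v, V, .and φ ψ => M.Sat v V φ ∧ M.Sat v V ψ
  | _, _, v, V, .or φ ψ => M.Sat v V φ ∨ M.Sat v V ψ
  | _, _, v, V, .imp φ ψ => M.Sat v V φ → M.Sat v V ψ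
  | _, _, v, V, .all φ => ∀ a : M.carrier, M.Sat (Fin.cons a v : Fin _ → M.carrier) V φ
  | _, _, v, V, .ex φ => ∃ a : M.carrier, M.Sat (Fin.cons a v : Fin _ → M.carrier) V φ
  | _, _, v, V, .allSet φ => ∀ A ∈ M.sets, M.Sat v (Fin.cons A V : Fin _ → Set M.carrier) φ
  | _, _, v, V, .exSet φ => ∃ A ∈ M.sets, M.Sat v (Fin.cons A V : Fin _ → Set M.carrier) φ

/-- Truth of a sentence in a structure. -/
def Model.Satisfies (M : Model.{u}) (φ : Sentence) : Prop := M.Sat Fin.elim0 Fin.elim0 φ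

/-- Logical consequence: `φ` is true in all structures in which all sentences of `T` are true. -/
def Entails (T : Set Sentence) (φ : Sentence) : Prop :=
  ∀ M : Model.{u}, (∀ ψ ∈ T, M.Satisfies ψ) → M.Satisfies φ

/-! ### Axioms -/

open Formula in
/-- The basic axioms on `0`, `1`, `+`, `·` and `<`. -/
inductive BasicAxiom : Sentence → Prop
  /-- `m + 1 ≠ 0` -/
  | succ_ne_zero : BasicAxiom (.all (.not (.eq (.var 0 + 1) 0)))
  /-- `m + 1 = n + 1 → m = n` -/
  | succ_inj : BasicAxiom
      (.all (.all (.imp (.eq (.var 1 + 1) (.var 0 + 1)) (.eq (.var 1) (.var 0)))))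
  /-- `m + 0 = m` -/
  | add_zero : BasicAxiom (.all (.eq (.var 0 + 0) (.var 0)))
  /-- `m + (n + 1) = (m + n) + 1` -/
  | add_succ : BasicAxiom
      (.all (.all (.eq (.var 1 + (.var 0 + 1)) ((.var 1 + .var 0) + 1))))
  /-- `m · 0 = 0` -/
  | mul_zero : BasicAxiom (.all (.eq (.var 0 * 0) 0))
  /-- `m · (n + 1) = m · n + m` -/
  | mul_succ : BasicAxiom
      (.all (.all (.eq (.var 1 * (.var 0 + 1)) (.var 1 * .var 0 + .var 1))))
  /-- `¬ m < 0` -/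
  | not_lt_zero : BasicAxiom (.all (.not (.lt (.var 0) 0)))
  /-- `m < n + 1 ↔ m < n ∨ m = n` -/
  | lt_succ : BasicAxiom
      (.all (.all (iff (.lt (.var 1) (.var 0 + 1))
        (.or (.lt (.var 1) (.var 0)) (.eq (.var 1) (.var 0))))))

/-- `(φ(0) ∧ ∀ x (φ(x) → φ(x + 1))) → ∀ x φ(x)`, where `x` is the number variable with index `0`
of `φ` and the other free variables are parameters. -/
def inductionFor {n k : ℕ} (φ : Formula (n + 1) k) : Formula n k :=
  ((φ.subst (Fin.cons (0 : Term n) Term.var) id).and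
    (.all (φ.imp (φ.subst (Fin.cons (Term.var 0 + 1 : Term (n + 1)) fun i => .var i.succ) id)))).imp
    (.all φ)

/-- `∃ X ∀ x (x ∈ X ↔ φ(x))`, where `x` is the number variable with index `0` of `φ`, the other
free variables are parameters, and `X` is not free in `φ`. -/
def comprehensionFor {n k : ℕ} (φ : Formula (n + 1) k) : Formula n k :=
  .exSet (.all (Formula.iff (.mem (.var 0) 0) (φ.subst Term.var Fin.succ)))

/-- The axioms of `RCA₀`: the basic axioms, `Σ⁰₁` induction and `Δ⁰₁` comprehension. -/
inductive RCA0 : Set Sentence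
  | basic {φ : Sentence} : BasicAxiom φ → RCA0 φ
  | induction {n k : ℕ} {φ : Formula (n + 1) k} : φ.IsSigma01 → RCA0 (inductionFor φ).close
  | comprehension {n k : ℕ} {φ ψ : Formula (n + 1) k} : φ.IsSigma01 → ψ.IsPi01 →
      RCA0 ((Formula.all (φ.iff ψ)).imp (comprehensionFor φ)).close

/-- The arithmetical comprehension scheme. -/
inductive ArithmeticalComprehension : Set Sentence
  | intro {n k : ℕ} {φ : Formula (n + 1) k} : φ.IsArithmetical →
      ArithmeticalComprehension (comprehensionFor φ).close

/-! ### Orders in second-order arithmetic -/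

/-- The code `(s + t)² + s` of the ordered pair of `s` and `t`. -/
def pair {n : ℕ} (s t : Term n) : Term n := (s + t) * (s + t) + s

/-- `s ≤_X t`.  A binary relation is coded by the set `X` of the codes of its pairs. -/
def ordLe {n k : ℕ} (X : Fin k) (s t : Term n) : Formula n k := .mem (pair s t) X

/-- `s <_X t`. -/
def ordLt {n k : ℕ} (X : Fin k) (s t : Term n) : Formula n k := (ordLe X s t).and (.not (.eq s t))

/-- `t` is an element of the order `X`, that is, of its field. -/
def inField {n k : ℕ} (X : Fin k) (t : Term n) : Formula n k := ordLe X t t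

/-- `X` is a (reflexive) linear order on its field. -/
def linearOrder {n k : ℕ} (X : Fin k) : Formula n k :=
  -- related elements belong to the field
  (Formula.all (.all (.imp (ordLe X (.var 1) (.var 0))
    ((inField X (.var 1)).and (inField X (.var 0)))))).and <|
  -- antisymmetry
  (Formula.all (.all (.imp ((ordLe X (.var 1) (.var 0)).and (ordLe X (.var 0) (.var 1)))
    (.eq (.var 1) (.var 0))))).and <|
  -- transitivity
  (Formula.all (.all (.all (.imp ((ordLe X (.var 2) (.var 1)).and (ordLe X (.var 1) (.var 0)))
    (ordLe X (.var 2) (.var 0)))))).and <|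
  -- totality
  Formula.all (.all (.imp ((inField X (.var 1)).and (inField X (.var 0)))
    ((ordLe X (.var 1) (.var 0)).or (ordLe X (.var 0) (.var 1)))))

/-- `F` is (the graph of) a function from the class `A` to the class `B`. -/
def function {n k : ℕ} (A B : {m : ℕ} → Term m → Formula m k) (F : Fin k) : Formula n k :=
  -- `F ⊆ A × B`
  (Formula.all (.imp (.mem (.var 0) F)
    (.ex (.ex (.and (.eq (.var 2) (pair (.var 1) (.var 0)))
      ((A (.var 1)).and (B (.var 0)))))))).and <|
  -- existence of values
  (Formula.all (.imp (A (.var 0)) (.ex (.mem (pair (.var 1) (.var 0)) F)))).and <|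
  -- uniqueness of values
  Formula.all (.all (.all (.imp
    (.and (.mem (pair (.var 2) (.var 1)) F) (.mem (pair (.var 2) (.var 0)) F))
    (.eq (.var 1) (.var 0)))))

/-- `F` is a descending sequence in `X`: a function from the natural numbers to the field of `X`
with `F(i + 1) <_X F(i)` for all `i`. -/
def descendingSequence {n k : ℕ} (X F : Fin k) : Formula n k :=
  (function (fun t => .eq t t) (fun t => inField X t) F).and <|
  Formula.all (.all (.all (.imp
    (.and (.mem (pair (.var 2) (.var 1)) F) (.mem (pair (.var 2 + 1) (.var 0)) F))
    (ordLt X (.var 0) (.var 1)))))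

/-- `X` is a well order: a linear order without descending sequences. -/
def wellOrder {n k : ℕ} (X : Fin k) : Formula n k :=
  (linearOrder X).and (.not (.exSet (descendingSequence X.succ 0)))

/-- `A ⊆ B`. -/
def subset {n k : ℕ} (A B : Fin k) : Formula n k :=
  .all (.imp (.mem (.var 0) A) (.mem (.var 0) B))

/-- `I` is an initial segment of the order `X`. -/
def initialSegment {n k : ℕ} (X I : Fin k) : Formula n k :=
  (Formula.all (.imp (.mem (.var 0) I) (inField X (.var 0)))).and <|
  Formula.all (.all (.imp (.and (ordLt X (.var 1) (.var 0)) (.mem (.var 0) I)) (.mem (.var 1) I)))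

/-- `F` is an embedding of `I` into `J`, for subsets `I` and `J` of the linear order `X`: a function
such that `x <_X y` implies `F(x) <_X F(y)` for all `x, y` in `I`. -/
def embedding {n k : ℕ} (X I J F : Fin k) : Formula n k :=
  (function (fun t => .mem t I) (fun t => .mem t J) F).and <|
  -- the variables with indices `3, 2, 1, 0` stand for `x, y, F(x), F(y)`
  Formula.all (.all (.all (.all (.imp
    (.and (ordLt X (.var 3) (.var 2))
      (.and (.mem (pair (.var 3) (.var 1)) F) (.mem (pair (.var 2) (.var 0)) F)))
    (ordLt X (.var 1) (.var 0))))))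

/-- `X` is a weak well order: a linear order such that there is no embedding `F` of an initial
segment `I` of `X` into an initial segment `J` that is properly contained in `I`.  The set variables
with indices `2, 1, 0` below the quantifiers stand for `I, J, F`. -/
def weakWellOrder {n k : ℕ} (X : Fin k) : Formula n k :=
  (linearOrder X).and <| .not <| .exSet <| .exSet <| .exSet <|
    (initialSegment X.succ.succ.succ 2).and <|
    (initialSegment X.succ.succ.succ 1).and <|
    ((subset 1 2).and (.not (subset 2 1))).and <|
    embedding X.succ.succ.succ 2 1 0

/-- Every weak well order is a well order. -/
def weakWellOrdersAreWellOrders : Sentence :=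
  .allSet ((weakWellOrder 0).imp (wellOrder 0))

end SOA

/-!
Arithmetical comprehension amounts to the existence of projections of sets. Such a projection is
decided by the true stages (Dekker) of an enumeration of it: the stages after which no smaller
number is enumerated. Order the stages by putting a stage below those later ones at which it still
appears to be true, and above the other later ones. A true stage has finitely many predecessors and
any other stage has finitely many successors. Stages that enumerate nothing descend in this order,
and there are infinitely many of them by construction, so it is not a well order and, by
hypothesis, not a weak well order.

Let `f` embed an initial segment into a proper initial segment of it. The elements that `f` moves
downwards form a nonempty set `D` closed under `f`, since `f z < z` implies `f (f z) < f z`. A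
member of `D` with finitely many predecessors would yield a least member `u` of `D`, contradicting
`f u < u`. An element `z ∉ D` with finitely many successors and below a member of `D` would yield a
least member `u` of `D` above `z`, contradicting `z ≤ f z < f u < u`. So, for any `x ∈ D`, the true
stages are the elements below `x` and outside `D`, and these form a set.
-/

namespace SOA

theorem apply_cons {α β : Type*} {n : ℕ} (g : α → β) (a : α) (f : Fin n → α) :
    (fun i => g ((Fin.cons a f : Fin (n + 1) → α) i)) = Fin.cons (g a) fun i => g (f i) :=
  Fin.comp_cons g a f

namespace Term

variable {n m l : ℕ}

theorem subst_subst (σ : Fin n → Term m) (τ : Fin m → Term l) (t : Term n) :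
    (t.subst σ).subst τ = t.subst fun i => (σ i).subst τ := by
  induction t with
  | var | zero | one => rfl
  | add _ _ ihs iht | mul _ _ ihs iht => simp only [subst, ihs, iht]

theorem lift_subst (σ : Fin n → Term m) (t : Term n) :
    t.lift.subst (Fin.cons (.var 0) fun i => (σ i).lift) = (t.subst σ).lift := by
  simp only [lift, subst_subst, subst, Fin.cons_succ]

end Term

theorem Formula.IsSigma00.subst {n m k l : ℕ} {φ : Formula n k} (hφ : φ.IsSigma00)
    (σ : Fin n → Term m) (ρ : Fin k → Fin l) : (φ.subst σ ρ).IsSigma00 := by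
  induction hφ generalizing m l with
  | eq | lt | mem => constructor
  | not _ ih => exact .not (ih _ _)
  | and _ _ ih₁ ih₂ => exact .and (ih₁ _ _) (ih₂ _ _)
  | or _ _ ih₁ ih₂ => exact .or (ih₁ _ _) (ih₂ _ _)
  | imp _ _ ih₁ ih₂ => exact .imp (ih₁ _ _) (ih₂ _ _)
  | ball t _ ih =>
    simpa only [Formula.ball, Formula.subst, Term.subst, Fin.cons_zero, Term.lift_subst] using
      IsSigma00.ball (t.subst σ) (ih (Fin.cons (.var 0) fun i => (σ i).lift) ρ)
  | bex t _ ih =>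
    simpa only [Formula.bex, Formula.subst, Term.subst, Fin.cons_zero, Term.lift_subst] using
      IsSigma00.bex (t.subst σ) (ih (Fin.cons (.var 0) fun i => (σ i).lift) ρ)

namespace Model

instance (M : Model.{u}) : Zero M.carrier := ⟨M.zero⟩
instance (M : Model.{u}) : One M.carrier := ⟨M.one⟩
instance (M : Model.{u}) : Add M.carrier := ⟨M.add⟩
instance (M : Model.{u}) : Mul M.carrier := ⟨M.mul⟩
instance (M : Model.{u}) : LT M.carrier := ⟨M.lt⟩

variable {M : Model.{u}}

/-! ### Substitution and satisfaction -/

section Satisfaction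

variable {n m k l : ℕ}

theorem val_subst (v : Fin m → M.carrier) (σ : Fin n → Term m) (t : Term n) :
    M.val v (t.subst σ) = M.val (fun i => M.val v (σ i)) t := by
  induction t with
  | var | zero | one => rfl
  | add _ _ ihs iht | mul _ _ ihs iht => simp only [Term.subst, val, ihs, iht]

theorem val_lift (a : M.carrier) (v : Fin n → M.carrier) (t : Term n) :
    M.val (Fin.cons a v : Fin (n + 1) → M.carrier) t.lift = M.val v t := by
  simp only [Term.lift, val_subst, val, Fin.cons_succ]

theorem sat_subst (φ : Formula n k) (v : Fin m → M.carrier) (V : Fin l → Set M.carrier)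
    (σ : Fin n → Term m) (ρ : Fin k → Fin l) :
    M.Sat v V (φ.subst σ ρ) ↔ M.Sat (fun i => M.val v (σ i)) (fun i => V (ρ i)) φ := by
  induction φ generalizing m l with
  | eq | lt | mem => simp only [Formula.subst, Sat, val_subst]
  | not _ ih => simp only [Formula.subst, Sat, ih]
  | and _ _ ih₁ ih₂ | or _ _ ih₁ ih₂ | imp _ _ ih₁ ih₂ => simp only [Formula.subst, Sat, ih₁, ih₂]
  | all _ ih | ex _ ih =>
    simp only [Formula.subst, Sat, ih, apply_cons, val, val_lift, Fin.cons_zero]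
  | allSet _ ih | exSet _ ih =>
    simp only [Formula.subst, Sat, ih, apply_cons, Fin.cons_zero, Fin.cons_succ]

theorem sat_closeNum (φ : Formula n k) (V : Fin k → Set M.carrier) :
    M.Sat Fin.elim0 V φ.closeNum ↔ ∀ v, M.Sat v V φ := by
  induction n with
  | zero => exact ⟨fun h v => by rwa [Subsingleton.elim v Fin.elim0], fun h => h _⟩
  | succ n ih =>
    rw [Formula.closeNum, ih]
    refine ⟨fun h v => ?_, fun h v a => h _⟩
    rw [← Fin.cons_self_tail v]
    exact h _ _

theorem sat_closeSet (φ : Formula n k) (v : Fin n → M.carrier) :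
    M.Sat v Fin.elim0 φ.closeSet ↔
      ∀ V : Fin k → Set M.carrier, (∀ i, V i ∈ M.sets) → M.Sat v V φ := by
  induction k with
  | zero =>
    exact ⟨fun h V _ => by rwa [Subsingleton.elim V Fin.elim0], fun h => h _ fun i => i.elim0⟩
  | succ k ih =>
    rw [Formula.closeSet, ih]
    refine ⟨fun h V hV => ?_, fun h V hV A hA => h _ (Fin.cases hA hV)⟩
    rw [← Fin.cons_self_tail V]
    exact h _ (fun i => hV i.succ) _ (hV 0)

theorem satisfies_close (φ : Formula n k) :
    M.Satisfies φ.close ↔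
      ∀ V : Fin k → Set M.carrier, (∀ i, V i ∈ M.sets) → ∀ v, M.Sat v V φ := by
  simp only [Satisfies, Formula.close, sat_closeSet, sat_closeNum]

end Satisfaction

/-! ### Definability with parameters -/

section Definability

variable {n m p q k : ℕ}

/-- The substitution of variables for the `n` arguments and the `p` parameters of an expression. -/
def relabel (f : Fin n → Fin m) (g : Fin p → Fin m) (i : Fin (n + p)) : Term m :=
  .var (Fin.append f g i)

theorem val_relabel (f : Fin n → Fin m) (g : Fin p → Fin m) (w : Fin m → M.carrier) :
    (fun i => M.val w (relabel f g i)) = Fin.append (fun i => w (f i)) fun j => w (g j) := by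
  funext i
  cases i using Fin.addCases <;> simp only [relabel, val, Fin.append_left, Fin.append_right]

/-- Relabels the parameters as the first block of a list of `p + q` parameters. -/
def leftParams : Fin (n + p) → Term (n + (p + q)) :=
  relabel (Fin.castAdd (p + q)) fun j => Fin.natAdd n (Fin.castAdd q j)

/-- Relabels the parameters as the last block of a list of `p + q` parameters. -/
def rightParams : Fin (n + q) → Term (n + (p + q)) :=
  relabel (Fin.castAdd (p + q)) fun j => Fin.natAdd n (Fin.natAdd p j)

theorem val_leftParams (v : Fin n → M.carrier) (c : Fin p → M.carrier) (d : Fin q → M.carrier) :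
    (fun i => M.val (Fin.append v (Fin.append c d)) (leftParams i)) = Fin.append v c := by
  simp only [leftParams, val_relabel, Fin.append_left, Fin.append_right]

theorem val_rightParams (v : Fin n → M.carrier) (c : Fin p → M.carrier) (d : Fin q → M.carrier) :
    (fun i => M.val (Fin.append v (Fin.append c d)) (rightParams i)) = Fin.append v d := by
  simp only [rightParams, val_relabel, Fin.append_left, Fin.append_right]

/-- Functions given by a term with parameters `c` from the structure. -/
@[fun_prop]
def TermDef (t : (Fin n → M.carrier) → M.carrier) : Prop :=
  ∃ (p : ℕ) (c : Fin p → M.carrier) (τ : Term (n + p)), ∀ v, M.val (Fin.append v c) τ = t v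

/-- Predicates given by a `Σ⁰₀` formula with parameters `c` and `V` from the structure. -/
@[fun_prop]
def Sigma00Def (P : (Fin n → M.carrier) → Prop) : Prop :=
  ∃ (p k : ℕ) (c : Fin p → M.carrier) (V : Fin k → Set M.carrier) (φ : Formula (n + p) k),
    (∀ i, V i ∈ M.sets) ∧ φ.IsSigma00 ∧ ∀ v, M.Sat (Fin.append v c) V φ ↔ P v

namespace TermDef

variable {s t : (Fin n → M.carrier) → M.carrier}

@[fun_prop]
theorem const (c : M.carrier) : TermDef fun _ : Fin n → M.carrier => c :=
  ⟨1, fun _ => c, .var (Fin.natAdd n 0), fun _ => Fin.append_right _ _ _⟩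

@[fun_prop]
theorem var (i : Fin n) : TermDef fun v : Fin n → M.carrier => v i :=
  ⟨0, Fin.elim0, .var (Fin.castAdd 0 i), fun _ => Fin.append_left _ _ _⟩

@[fun_prop]
theorem add (hs : TermDef s) (ht : TermDef t) : TermDef fun v => s v + t v := by
  obtain ⟨p, c, σ, hσ⟩ := hs
  obtain ⟨q, d, τ, hτ⟩ := ht
  refine ⟨p + q, Fin.append c d, .add (σ.subst leftParams) (τ.subst rightParams), fun v => ?_⟩
  simp only [val, val_subst, val_leftParams, val_rightParams, hσ, hτ]
  rfl

@[fun_prop]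
theorem mul (hs : TermDef s) (ht : TermDef t) : TermDef fun v => s v * t v := by
  obtain ⟨p, c, σ, hσ⟩ := hs
  obtain ⟨q, d, τ, hτ⟩ := ht
  refine ⟨p + q, Fin.append c d, .mul (σ.subst leftParams) (τ.subst rightParams), fun v => ?_⟩
  simp only [val, val_subst, val_leftParams, val_rightParams, hσ, hτ]
  rfl

theorem val (t : Term n) : TermDef fun v => M.val v t := by
  induction t with
  | var i => exact .var i
  | zero => exact .const M.zero
  | one => exact .const M.one
  | add s t hs ht => exact hs.add ht
  | mul s t hs ht => exact hs.mul ht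

end TermDef

namespace Sigma00Def

variable {s t : (Fin n → M.carrier) → M.carrier} {P Q : (Fin n → M.carrier) → Prop}

@[fun_prop]
theorem eq (hs : TermDef s) (ht : TermDef t) : Sigma00Def fun v => s v = t v := by
  obtain ⟨p, c, σ, hσ⟩ := hs
  obtain ⟨q, d, τ, hτ⟩ := ht
  refine ⟨p + q, 0, Fin.append c d, Fin.elim0, .eq (σ.subst leftParams) (τ.subst rightParams),
    fun i => i.elim0, .eq _ _, fun v => ?_⟩
  simp only [Sat, val_subst, val_leftParams, val_rightParams, hσ, hτ]

@[fun_prop]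
theorem lt (hs : TermDef s) (ht : TermDef t) : Sigma00Def fun v => s v < t v := by
  obtain ⟨p, c, σ, hσ⟩ := hs
  obtain ⟨q, d, τ, hτ⟩ := ht
  refine ⟨p + q, 0, Fin.append c d, Fin.elim0, .lt (σ.subst leftParams) (τ.subst rightParams),
    fun i => i.elim0, .lt _ _, fun v => ?_⟩
  simp only [Sat, val_subst, val_leftParams, val_rightParams, hσ, hτ]
  rfl

@[fun_prop]
theorem mem {A : Set M.carrier} (hA : A ∈ M.sets) (ht : TermDef t) :
    Sigma00Def fun v => t v ∈ A := by
  obtain ⟨p, c, τ, hτ⟩ := ht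
  refine ⟨p, 1, c, fun _ => A, .mem τ 0, fun _ => hA, .mem _ _, fun v => ?_⟩
  simp only [Sat, hτ]

@[fun_prop]
theorem not (hP : Sigma00Def P) : Sigma00Def fun v => ¬ P v := by
  obtain ⟨p, k, c, V, φ, hV, hφ, h⟩ := hP
  exact ⟨p, k, c, V, φ.not, hV, hφ.not, fun v => not_congr (h v)⟩

theorem exists_common_params (hP : Sigma00Def P) (hQ : Sigma00Def Q) :
    ∃ (p k : ℕ) (c : Fin p → M.carrier) (V : Fin k → Set M.carrier) (φ ψ : Formula (n + p) k),
      (∀ i, V i ∈ M.sets) ∧ φ.IsSigma00 ∧ ψ.IsSigma00 ∧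
      (∀ v, M.Sat (Fin.append v c) V φ ↔ P v) ∧ ∀ v, M.Sat (Fin.append v c) V ψ ↔ Q v := by
  obtain ⟨p, k, c, V, φ, hV, hφ, h⟩ := hP
  obtain ⟨q, l, d, W, ψ, hW, hψ, h'⟩ := hQ
  refine ⟨p + q, k + l, Fin.append c d, Fin.append V W, φ.subst leftParams (Fin.castAdd l),
    ψ.subst rightParams (Fin.natAdd k), fun i => ?_, hφ.subst _ _, hψ.subst _ _,
    fun v => ?_, fun v => ?_⟩
  · cases i using Fin.addCases with
    | left i => simpa only [Fin.append_left] using hV i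
    | right i => simpa only [Fin.append_right] using hW i
  · simpa only [sat_subst, val_leftParams, Fin.append_left] using h v
  · simpa only [sat_subst, val_rightParams, Fin.append_right] using h' v

@[fun_prop]
theorem and (hP : Sigma00Def P) (hQ : Sigma00Def Q) : Sigma00Def fun v => P v ∧ Q v := by
  obtain ⟨p, k, c, V, φ, ψ, hV, hφ, hψ, h, h'⟩ := hP.exists_common_params hQ
  exact ⟨p, k, c, V, φ.and ψ, hV, hφ.and hψ, fun v => and_congr (h v) (h' v)⟩

@[fun_prop]
theorem or (hP : Sigma00Def P) (hQ : Sigma00Def Q) : Sigma00Def fun v => P v ∨ Q v := by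
  obtain ⟨p, k, c, V, φ, ψ, hV, hφ, hψ, h, h'⟩ := hP.exists_common_params hQ
  exact ⟨p, k, c, V, φ.or ψ, hV, hφ.or hψ, fun v => or_congr (h v) (h' v)⟩

@[fun_prop]
theorem imp (hP : Sigma00Def P) (hQ : Sigma00Def Q) : Sigma00Def fun v => P v → Q v := by
  obtain ⟨p, k, c, V, φ, ψ, hV, hφ, hψ, h, h'⟩ := hP.exists_common_params hQ
  exact ⟨p, k, c, V, φ.imp ψ, hV, hφ.imp hψ, fun v => imp_congr (h v) (h' v)⟩

theorem rename (hP : Sigma00Def P) (f : Fin n → Fin m) :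
    Sigma00Def fun v : Fin m → M.carrier => P fun i => v (f i) := by
  obtain ⟨p, k, c, V, φ, hV, hφ, h⟩ := hP
  refine ⟨p, k, c, V, φ.subst (relabel (fun i => Fin.castAdd p (f i)) (Fin.natAdd m)) id, hV,
    hφ.subst _ _, fun v => ?_⟩
  simp only [sat_subst, val_relabel, Fin.append_left, Fin.append_right, id, h]

theorem cons_const {P : (Fin (n + 1) → M.carrier) → Prop} (hP : Sigma00Def P)
    (v : Fin n → M.carrier) : Sigma00Def fun x : Fin 1 → M.carrier => P (Fin.cons (x 0) v) := by
  obtain ⟨p, k, c, V, φ, hV, hφ, h⟩ := hP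
  refine ⟨n + p, k, Fin.append v c, V, φ.subst (relabel
    (Fin.cons (Fin.castAdd (n + p) 0) fun i => Fin.natAdd 1 (Fin.castAdd p i))
    fun j => Fin.natAdd 1 (Fin.natAdd n j)) id, hV, hφ.subst _ _, fun x => ?_⟩
  simp only [sat_subst, val_relabel, apply_cons, Fin.append_left, Fin.append_right, id, h]

@[fun_prop]
theorem ball {R : M.carrier → (Fin n → M.carrier) → Prop} (ht : TermDef t)
    (hR : Sigma00Def fun v : Fin (n + 1) → M.carrier => R (v 0) fun i => v i.succ) :
    Sigma00Def fun v => ∀ a, a < t v → R a v := by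
  obtain ⟨p, c, τ, hτ⟩ := ht
  obtain ⟨q, k, d, V, φ, hV, hφ, h⟩ := hR
  let outermost : Fin (n + 1 + q) → Term (n + (p + q) + 1) :=
    relabel (Fin.cons 0 fun i => (Fin.castAdd (p + q) i).succ) fun j =>
      (Fin.natAdd n (Fin.natAdd p j)).succ
  refine ⟨p + q, k, Fin.append c d, V, (φ.subst outermost id).ball (τ.subst leftParams), hV,
    .ball _ (hφ.subst _ _), fun v => ?_⟩
  simp only [Formula.ball, Sat, sat_subst, outermost, val_relabel, val_lift, val_subst,
    val_leftParams, hτ, id, val, Fin.cons_zero, Fin.cons_succ, Fin.append_left, Fin.append_right, h]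
  rfl

@[fun_prop]
theorem bex {R : M.carrier → (Fin n → M.carrier) → Prop} (ht : TermDef t)
    (hR : Sigma00Def fun v : Fin (n + 1) → M.carrier => R (v 0) fun i => v i.succ) :
    Sigma00Def fun v => ∃ a, a < t v ∧ R a v := by
  simpa only [not_forall, not_not, exists_prop] using (ball (R := fun a v => ¬ R a v) ht hR.not).not

end Sigma00Def

/-- The code of the pair of `a` and `b`, as in the term `SOA.pair`. -/
def pr (a b : M.carrier) : M.carrier := (a + b) * (a + b) + a

@[fun_prop]
theorem TermDef.pr {s t : (Fin n → M.carrier) → M.carrier} (hs : TermDef s) (ht : TermDef t) :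
    TermDef fun v => pr (s v) (t v) := by
  unfold Model.pr
  fun_prop

/-- The code of a tuple, by iterated pairing from the right. -/
def tuple : {n : ℕ} → (Fin n → M.carrier) → M.carrier
  | 0, _ => 0
  | _ + 1, v => pr (v 0) (tuple fun i => v i.succ)

theorem TermDef.tuple (f : Fin n → Fin m) :
    TermDef fun v : Fin m → M.carrier => tuple fun i => v (f i) := by
  induction n with
  | zero => exact .const 0
  | succ n ih => exact .pr (.var _) (ih fun i => f i.succ)

end Definability

/-! ### Orders in a structure -/

section Orders

/-- The set `X` codes a linear order, as in the formula `SOA.linearOrder`. -/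
def IsLinear (X : Set M.carrier) : Prop :=
  (∀ a b, pr a b ∈ X → pr a a ∈ X ∧ pr b b ∈ X) ∧
  (∀ a b, pr a b ∈ X ∧ pr b a ∈ X → a = b) ∧
  (∀ a b c, pr a b ∈ X ∧ pr b c ∈ X → pr a c ∈ X) ∧
  ∀ a b, pr a a ∈ X ∧ pr b b ∈ X → pr a b ∈ X ∨ pr b a ∈ X

/-- The set `F` codes a function from the class `A` to the class `B`, as in the formula
`SOA.function`. -/
def IsFunction (A B : M.carrier → Prop) (F : Set M.carrier) : Prop :=
  (∀ p, p ∈ F → ∃ a b, p = pr a b ∧ A a ∧ B b) ∧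
  (∀ a, A a → ∃ b, pr a b ∈ F) ∧
  ∀ a b c, pr a b ∈ F ∧ pr a c ∈ F → b = c

/-- The set `I` is an initial segment of `X`, as in the formula `SOA.initialSegment`. -/
def IsInitial (X I : Set M.carrier) : Prop :=
  (∀ a, a ∈ I → pr a a ∈ X) ∧ ∀ a b, (pr a b ∈ X ∧ ¬ a = b) ∧ b ∈ I → a ∈ I

/-- The set `F` codes an embedding of `I` into `J`, as in the formula `SOA.embedding`. -/
def IsEmbedding (X I J F : Set M.carrier) : Prop :=
  IsFunction (· ∈ I) (· ∈ J) F ∧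
  ∀ a b c d, (pr a b ∈ X ∧ ¬ a = b) ∧ pr a c ∈ F ∧ pr b d ∈ F → pr c d ∈ X ∧ ¬ c = d

/-- The set `X` codes a well order, in the sense of the structure. -/
def IsWellOrder (X : Set M.carrier) : Prop :=
  M.Sat Fin.elim0 (Fin.cons X Fin.elim0 : Fin 1 → Set M.carrier) (wellOrder 0)

/-- The set `X` codes a weak well order, in the sense of the structure. -/
def IsWeakWellOrder (X : Set M.carrier) : Prop :=
  M.Sat Fin.elim0 (Fin.cons X Fin.elim0 : Fin 1 → Set M.carrier) (weakWellOrder 0)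

theorem isWellOrder_iff {X : Set M.carrier} :
    IsWellOrder X ↔
      IsLinear X ∧ ¬ ∃ F ∈ M.sets, IsFunction (fun a => a = a) (fun a => pr a a ∈ X) F ∧
        ∀ a b c, pr a b ∈ F ∧ pr (a + 1) c ∈ F → pr c b ∈ X ∧ ¬ c = b :=
  Iff.rfl

theorem isWeakWellOrder_iff {X : Set M.carrier} :
    IsWeakWellOrder X ↔
      IsLinear X ∧ ¬ ∃ I ∈ M.sets, ∃ J ∈ M.sets, ∃ F ∈ M.sets, IsInitial X I ∧ IsInitial X J ∧
        ((∀ a, a ∈ J → a ∈ I) ∧ ¬ ∀ a, a ∈ I → a ∈ J) ∧ IsEmbedding X I J F :=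
  Iff.rfl

/-- A linear order on all numbers, coded by the set `X`. -/
structure IsTotalOrder (X : Set M.carrier) : Prop where
  antisymm : ∀ {a b}, pr a b ∈ X → pr b a ∈ X → a = b
  trans : ∀ {a b c}, pr a b ∈ X → pr b c ∈ X → pr a c ∈ X
  total : ∀ a b, pr a b ∈ X ∨ pr b a ∈ X

namespace IsTotalOrder

variable {X : Set M.carrier}

theorem refl (h : IsTotalOrder X) (a : M.carrier) : pr a a ∈ X :=
  or_self_iff.1 (h.total a a)

theorem isLinear (h : IsTotalOrder X) : IsLinear X :=
  ⟨fun a b _ => ⟨h.refl a, h.refl b⟩, fun _ _ hab => h.antisymm hab.1 hab.2,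
    fun _ _ _ habc => h.trans habc.1 habc.2, fun a b _ => h.total a b⟩

end IsTotalOrder

/-- A strictly increasing map of an initial segment `I` of the total order `X` into itself. -/
structure IsSelfEmbedding (X I : Set M.carrier) (f : M.carrier → M.carrier) : Prop where
  mem_of_le : ∀ {a b}, pr a b ∈ X → b ∈ I → a ∈ I
  map_mem : ∀ {a}, a ∈ I → f a ∈ I
  strict_mono : ∀ {a b}, a ∈ I → b ∈ I → pr a b ∈ X → a ≠ b → pr (f a) (f b) ∈ X ∧ f a ≠ f b

/-- The elements that a self-embedding moves downwards. -/
def loweredSet (X I : Set M.carrier) (f : M.carrier → M.carrier) : Set M.carrier :=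
  {z | z ∈ I ∧ pr z (f z) ∉ X}

theorem IsSelfEmbedding.map_mem_loweredSet {X I : Set M.carrier} {f : M.carrier → M.carrier}
    (hf : IsSelfEmbedding X I f) (hX : IsTotalOrder X) {z : M.carrier}
    (hz : z ∈ loweredSet X I f) : f z ∈ loweredSet X I f := by
  obtain ⟨hzI, hzf⟩ := hz
  have hfz : pr (f z) z ∈ X := (hX.total _ _).resolve_left hzf
  have hne : f z ≠ z := fun h => hzf (h.symm ▸ hX.refl z)
  obtain ⟨hle, hne'⟩ := hf.strict_mono (hf.map_mem hzI) hzI hfz hne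
  exact ⟨hf.map_mem hzI, fun h => hne' (hX.antisymm hle h)⟩

end Orders

/-- Structures in which the axioms of `RCA₀` are true. -/
class IsRCA0 (M : Model.{u}) : Prop where
  satisfies : ∀ ψ ∈ RCA0, M.Satisfies ψ

variable [hM : M.IsRCA0]

/-! ### Induction and comprehension -/

section Axioms

theorem sigma01_induction {Q : M.carrier → M.carrier → Prop}
    (definable : Sigma00Def fun v : Fin 2 → M.carrier => Q (v 0) (v 1)) (zero : ∃ m, Q m 0)
    (succ : ∀ x, (∃ m, Q m x) → ∃ m, Q m (x + 1)) (x : M.carrier) : ∃ m, Q m x := by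
  obtain ⟨p, k, c, V, φ, hV, hφ, h⟩ := definable
  let toFront : Fin (2 + p) → Term (p + 1 + 1) := relabel ![0, 1] fun j => j.succ.succ
  have := (satisfies_close _).1
    (hM.satisfies _ (.induction ⟨φ.subst toFront id, hφ.subst _ _, rfl⟩)) V hV c
  simp only [inductionFor, Sat, sat_subst, toFront, val_relabel, val, Fin.cons_succ, id, h] at this
  exact this ⟨zero, succ⟩ x

theorem sigma00_induction {Q : M.carrier → Prop}
    (definable : Sigma00Def fun v : Fin 1 → M.carrier => Q (v 0)) (zero : Q 0)
    (succ : ∀ x, Q x → Q (x + 1)) (x : M.carrier) : Q x :=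
  (sigma01_induction (Q := fun _ x => Q x) (definable.rename fun _ => 1) ⟨0, zero⟩
    (fun x ⟨_, h⟩ => ⟨0, succ x h⟩) x).elim fun _ h => h

theorem delta01_comprehension {Q R : M.carrier → M.carrier → Prop}
    (hQ : Sigma00Def fun v : Fin 2 → M.carrier => Q (v 0) (v 1))
    (hR : Sigma00Def fun v : Fin 2 → M.carrier => R (v 0) (v 1))
    (hQR : ∀ x, (∃ m, Q m x) ↔ ∀ m, R m x) : {x | ∃ m, Q m x} ∈ M.sets := by
  obtain ⟨p, k, c, V, φ, ψ, hV, hφ, hψ, h, h'⟩ := hQ.exists_common_params hR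
  let toFront : Fin (2 + p) → Term (p + 1 + 1) := relabel ![0, 1] fun j => j.succ.succ
  have := (satisfies_close _).1 (hM.satisfies _ (.comprehension
    ⟨φ.subst toFront id, hφ.subst _ _, rfl⟩ ⟨ψ.subst toFront id, hψ.subst _ _, rfl⟩)) V hV c
  simp only [comprehensionFor, Formula.iff, Sat, sat_subst, toFront, val_relabel, val,
    Fin.cons_succ, id, h, h'] at this
  obtain ⟨A, hA, hA'⟩ := this fun x => ⟨(hQR x).1, (hQR x).2⟩
  convert hA
  ext x
  exact ⟨(hA' x).2, (hA' x).1⟩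

theorem sigma00_comprehension {Q : M.carrier → Prop}
    (hQ : Sigma00Def fun v : Fin 1 → M.carrier => Q (v 0)) : {x | Q x} ∈ M.sets := by
  have hQ' := hQ.rename (m := 2) fun _ => 1
  simpa only [exists_const_iff, exists_const, Nonempty.intro (0 : M.carrier), true_and] using
    delta01_comprehension (Q := fun _ x => Q x) (R := fun _ x => Q x) hQ' hQ' fun x =>
      ⟨fun ⟨_, h⟩ _ => h, fun h => ⟨0, h 0⟩⟩

end Axioms

/-! ### Arithmetic -/

section Arithmetic

protected theorem add_succ (a b : M.carrier) : a + (b + 1) = a + b + 1 :=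
  hM.satisfies _ (.basic .add_succ) a b

protected theorem mul_succ (a b : M.carrier) : a * (b + 1) = a * b + a :=
  hM.satisfies _ (.basic .mul_succ) a b

protected theorem add_zero (a : M.carrier) : a + 0 = a :=
  hM.satisfies _ (.basic .add_zero) a

protected theorem mul_zero (a : M.carrier) : a * 0 = 0 :=
  hM.satisfies _ (.basic .mul_zero) a

protected theorem zero_add (a : M.carrier) : 0 + a = a := by
  induction a using sigma00_induction with
  | definable => fun_prop
  | zero => exact Model.add_zero 0
  | succ a ih => rw [Model.add_succ, ih]

protected theorem succ_add (a b : M.carrier) : a + 1 + b = a + b + 1 := by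
  induction b using sigma00_induction with
  | definable => fun_prop
  | zero => rw [Model.add_zero, Model.add_zero]
  | succ b ih => rw [Model.add_succ, ih, Model.add_succ]

protected theorem add_comm (a b : M.carrier) : a + b = b + a := by
  induction b using sigma00_induction with
  | definable => fun_prop
  | zero => rw [Model.add_zero, Model.zero_add]
  | succ b ih => rw [Model.add_succ, ih, Model.succ_add]

protected theorem add_assoc (a b c : M.carrier) : a + b + c = a + (b + c) := by
  induction c using sigma00_induction with
  | definable => fun_prop
  | zero => rw [Model.add_zero, Model.add_zero]
  | succ c ih => simp only [Model.add_succ, ih]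

instance : AddCommMonoid M.carrier where
  add_assoc := Model.add_assoc
  zero_add := Model.zero_add
  add_zero := Model.add_zero
  add_comm := Model.add_comm
  nsmul := nsmulRec

protected theorem zero_mul (a : M.carrier) : 0 * a = 0 := by
  induction a using sigma00_induction with
  | definable => fun_prop
  | zero => exact Model.mul_zero 0
  | succ a ih => rw [Model.mul_succ, ih, Model.add_zero]

protected theorem succ_mul (a b : M.carrier) : (a + 1) * b = a * b + b := by
  induction b using sigma00_induction with
  | definable => fun_prop
  | zero => simp only [Model.mul_zero, Model.add_zero]
  | succ b ih => rw [Model.mul_succ, ih, Model.mul_succ, add_add_add_comm]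

protected theorem mul_comm (a b : M.carrier) : a * b = b * a := by
  induction b using sigma00_induction with
  | definable => fun_prop
  | zero => rw [Model.mul_zero, Model.zero_mul]
  | succ b ih => rw [Model.mul_succ, ih, Model.succ_mul]

protected theorem mul_add (a b c : M.carrier) : a * (b + c) = a * b + a * c := by
  induction c using sigma00_induction with
  | definable => fun_prop
  | zero => rw [Model.mul_zero, add_zero, add_zero]
  | succ c ih => rw [Model.add_succ, Model.mul_succ, Model.mul_succ, ih, add_assoc]

protected theorem mul_assoc (a b c : M.carrier) : a * b * c = a * (b * c) := by
  induction c using sigma00_induction with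
  | definable => fun_prop
  | zero => simp only [Model.mul_zero]
  | succ c ih => rw [Model.mul_succ, Model.mul_succ, Model.mul_add, ih]

protected theorem mul_one (a : M.carrier) : a * 1 = a := by
  simpa only [zero_add, Model.mul_zero] using Model.mul_succ a 0

instance : CommSemiring M.carrier where
  left_distrib := Model.mul_add
  right_distrib a b c := by simp only [Model.mul_comm _ c, Model.mul_add]
  zero_mul := Model.zero_mul
  mul_zero := Model.mul_zero
  mul_assoc := Model.mul_assoc
  one_mul a := by rw [Model.mul_comm, Model.mul_one]
  mul_one := Model.mul_one
  mul_comm := Model.mul_comm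

protected theorem not_lt_zero (a : M.carrier) : ¬ a < 0 :=
  hM.satisfies _ (.basic .not_lt_zero) a

protected theorem lt_succ {a b : M.carrier} : a < b + 1 ↔ a < b ∨ a = b :=
  iff_iff_implies_and_implies.2 (hM.satisfies _ (.basic .lt_succ) a b)

protected theorem lt_trans {a b c : M.carrier} (hab : a < b) (hbc : b < c) : a < c := by
  induction c using sigma00_induction with
  | definable => fun_prop
  | zero => exact (Model.not_lt_zero b hbc).elim
  | succ c ih =>
    rcases Model.lt_succ.1 hbc with h | rfl
    · exact Model.lt_succ.2 (.inl (ih h))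
    · exact Model.lt_succ.2 (.inl hab)

protected theorem lt_irrefl (a : M.carrier) : ¬ a < a := by
  induction a using sigma00_induction with
  | definable => fun_prop
  | zero => exact Model.not_lt_zero 0
  | succ a ih =>
    have lt_self_succ : a < a + 1 := Model.lt_succ.2 (.inr rfl)
    rintro h
    rcases Model.lt_succ.1 h with h | h
    · exact ih (Model.lt_trans lt_self_succ h)
    · exact ih (by rwa [h] at lt_self_succ)

protected theorem succ_lt_succ {a b : M.carrier} (h : a < b) : a + 1 < b + 1 := by
  induction b using sigma00_induction with
  | definable => fun_prop
  | zero => exact (Model.not_lt_zero a h).elim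
  | succ b ih =>
    rcases Model.lt_succ.1 h with h | rfl
    · exact Model.lt_succ.2 (.inl (ih h))
    · exact Model.lt_succ.2 (.inr rfl)

protected theorem eq_zero_or_pos (a : M.carrier) : a = 0 ∨ 0 < a := by
  induction a using sigma00_induction with
  | definable => fun_prop
  | zero => exact .inl rfl
  | succ a ih => exact .inr (Model.lt_succ.2 (ih.symm.imp_right Eq.symm))

protected theorem lt_trichotomy (a b : M.carrier) : a < b ∨ a = b ∨ b < a := by
  induction b using sigma00_induction with
  | definable => fun_prop
  | zero => exact .inr (Model.eq_zero_or_pos a)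
  | succ b ih =>
    rcases ih with h | h | h
    · exact .inl (Model.lt_succ.2 (.inl h))
    · exact .inl (Model.lt_succ.2 (.inr h))
    · exact .inr ((Model.lt_succ.1 (Model.succ_lt_succ h)).symm.imp_left Eq.symm)

noncomputable instance : LinearOrder M.carrier where
  le a b := a < b ∨ a = b
  le_refl _ := .inr rfl
  le_trans a b c := by
    rintro (hab | rfl) (hbc | rfl)
    exacts [.inl (Model.lt_trans hab hbc), .inl hab, .inl hbc, .inr rfl]
  le_antisymm a b := by
    rintro (hab | rfl) (hba | h)
    exacts [(Model.lt_irrefl a (Model.lt_trans hab hba)).elim, h.symm, rfl, rfl]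
  lt_iff_le_not_ge a b := by
    refine ⟨fun hab => ⟨.inl hab, ?_⟩, fun ⟨hab, hba⟩ =>
      hab.resolve_right fun h => hba (.inr h.symm)⟩
    rintro (hba | rfl)
    exacts [Model.lt_irrefl a (Model.lt_trans hab hba), Model.lt_irrefl _ hab]
  le_total a b := by
    rcases Model.lt_trichotomy a b with h | h | h
    exacts [.inl (.inl h), .inl (.inr h), .inr (.inl h)]
  toDecidableLE := Classical.decRel _

protected theorem add_lt_add_right {a b : M.carrier} (h : a < b) (c : M.carrier) :
    a + c < b + c := by
  induction c using sigma00_induction with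
  | definable => fun_prop
  | zero => simpa only [add_zero] using h
  | succ c ih => simpa only [← add_assoc] using Model.succ_lt_succ ih

instance : IsOrderedCancelAddMonoid M.carrier where
  add_le_add_left _ _ h c := h.imp (Model.add_lt_add_right · c) (congrArg (· + c))
  le_of_add_le_add_left a b c h := by
    contrapose! h
    simpa only [add_comm a] using Model.add_lt_add_right h a

protected theorem exists_add_of_le {a b : M.carrier} (h : a ≤ b) : ∃ c, b = a + c := by
  suffices ∃ c, a < b → b = a + c by
    rcases h with hlt | rfl
    exacts [this.imp fun c hc => hc hlt, ⟨0, (add_zero a).symm⟩]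
  refine sigma01_induction (Q := fun c b => a < b → b = a + c) (by fun_prop)
    ⟨0, fun h => (Model.not_lt_zero a h).elim⟩ (fun x ⟨c, hc⟩ => ?_) b
  by_cases hax : a < x
  · exact ⟨c + 1, fun _ => by rw [← add_assoc, ← hc hax]⟩
  · exact ⟨1, fun h => by rw [(Model.lt_succ.1 h).resolve_left hax]⟩

instance : CanonicallyOrderedAdd M.carrier where
  exists_add_of_le := Model.exists_add_of_le
  le_self_add a b := by
    simpa using add_le_add_right (show 0 ≤ b from (Model.eq_zero_or_pos b).symm.imp_right .symm) a
  le_add_self a b := by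
    simpa using add_le_add_left (show 0 ≤ b from (Model.eq_zero_or_pos b).symm.imp_right .symm) a

instance : SuccAddOrder M.carrier where
  succ a := a + 1
  le_succ _ := le_self_add
  max_of_succ_le h := (Model.lt_irrefl _ (lt_of_lt_of_le (Model.lt_succ.2 (.inr rfl)) h)).elim
  succ_le_of_lt h := Model.lt_succ.1 (Model.succ_lt_succ h)
  succ_eq_add_one _ := rfl

instance : NoMaxOrder M.carrier := ⟨fun a => ⟨a + 1, Model.lt_succ.2 (.inr rfl)⟩⟩

theorem le_mul_self (a : M.carrier) : a ≤ a * a := by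
  rcases Model.eq_zero_or_pos a with rfl | h
  · exact zero_le
  · exact le_mul_of_one_le_left' (by simpa using Order.add_one_le_iff.2 h)

end Arithmetic

namespace Sigma00Def

variable {n : ℕ} {s t : (Fin n → M.carrier) → M.carrier}
  {R : M.carrier → (Fin n → M.carrier) → Prop}

@[fun_prop]
theorem le (hs : TermDef s) (ht : TermDef t) : Sigma00Def fun v => s v ≤ t v := by
  simp only [le_iff_lt_or_eq]
  fun_prop

@[fun_prop]
theorem ball_le (ht : TermDef t)
    (hR : Sigma00Def fun v : Fin (n + 1) → M.carrier => R (v 0) fun i => v i.succ) :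
    Sigma00Def fun v => ∀ a, a ≤ t v → R a v := by
  simpa only [Order.lt_add_one_iff] using ball (ht.add (.const 1)) hR

@[fun_prop]
theorem bex_le (ht : TermDef t)
    (hR : Sigma00Def fun v : Fin (n + 1) → M.carrier => R (v 0) fun i => v i.succ) :
    Sigma00Def fun v => ∃ a, a ≤ t v ∧ R a v := by
  simpa only [Order.lt_add_one_iff] using bex (ht.add (.const 1)) hR

end Sigma00Def

theorem left_le_pr (a b : M.carrier) : a ≤ pr a b := le_add_self

theorem right_le_pr (a b : M.carrier) : b ≤ pr a b :=
  calc b ≤ a + b := le_add_self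
    _ ≤ (a + b) * (a + b) := le_mul_self _
    _ ≤ pr a b := le_self_add

theorem pr_lt_pr_of_add_lt_add {a b c d : M.carrier} (h : a + b < c + d) : pr a b < pr c d :=
  calc pr a b ≤ (a + b) * (a + b) + (a + b) + (a + b) :=
        add_le_add_right (le_self_add.trans le_self_add) _ |>.trans_eq (add_assoc _ _ _).symm
    _ < (a + b) * (a + b) + (a + b) + (a + b) + 1 := Order.lt_succ _
    _ = (a + b + 1) * (a + b + 1) := by ring
    _ ≤ (c + d) * (c + d) :=
        mul_le_mul' (Order.add_one_le_iff.2 h) (Order.add_one_le_iff.2 h)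
    _ ≤ pr c d := le_self_add

theorem pr_inj {a b c d : M.carrier} : pr a b = pr c d ↔ a = c ∧ b = d := by
  refine ⟨fun h => ?_, fun ⟨h, h'⟩ => h ▸ h' ▸ rfl⟩
  have hsum : a + b = c + d := by
    by_contra hne
    rcases lt_or_gt_of_ne hne with hlt | hlt
    exacts [(pr_lt_pr_of_add_lt_add hlt).ne h, (pr_lt_pr_of_add_lt_add hlt).ne' h]
  obtain rfl : a = c := by simpa [pr, hsum] using h
  exact ⟨rfl, add_left_cancel hsum⟩

/-! ### Least elements -/

section Minimum

theorem exists_min_sigma01 {Q : M.carrier → M.carrier → Prop}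
    (hQ : Sigma00Def fun v : Fin 2 → M.carrier => Q (v 0) (v 1)) {x m : M.carrier} (hx : Q m x) :
    ∃ x, (∃ m, Q m x) ∧ ∀ y m, Q m y → x ≤ y := by
  by_contra! descend
  obtain ⟨z, y, -, m, -, hle, -⟩ : ∃ z, ∃ y ≤ z, ∃ m ≤ z, y + (x + 1) ≤ x ∧ Q m y := by
    refine sigma01_induction (Q := fun z b => ∃ y ≤ z, ∃ m ≤ z, y + b ≤ x ∧ Q m y)
      (.bex_le (.var 0) (.bex_le (.var 1) (.and (by fun_prop) (hQ.rename ![0, 1]))))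
      ⟨max x m, x, le_max_left _ _, m, le_max_right _ _, (add_zero x).le, hx⟩ ?_ _
    rintro b ⟨-, y, -, m, -, hle, hm⟩
    obtain ⟨y', m', hm', hlt⟩ := descend y ⟨m, hm⟩
    refine ⟨max y' m', y', le_max_left _ _, m', le_max_right _ _, ?_, hm'⟩
    calc y' + (b + 1) = y' + 1 + b := by ring
      _ ≤ y + b := add_le_add_left (Order.add_one_le_iff.2 hlt) b
      _ ≤ x := hle
  exact absurd (le_add_self.trans hle) (Order.lt_succ x).not_ge

theorem exists_min_of_bounded {B X : Set M.carrier} (hB : B ∈ M.sets) (hX : X ∈ M.sets)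
    (hXt : IsTotalOrder X) (hne : B.Nonempty) {k : M.carrier} (hk : ∀ a ∈ B, a ≤ k) :
    ∃ a ∈ B, ∀ b ∈ B, pr a b ∈ X := by
  suffices ∃ a, a ∈ B ∧ ∀ m < k + 1, m ∈ B → pr a m ∈ X by
    obtain ⟨a, ha, hmin⟩ := this
    exact ⟨a, ha, fun b hb => hmin b (Order.lt_add_one_iff.2 (hk b hb)) hb⟩
  refine sigma01_induction (Q := fun a n => a ∈ B ∧ ∀ m < n, m ∈ B → pr a m ∈ X)
    (by fun_prop (disch := assumption))
    (hne.imp fun a ha => ⟨ha, fun m hm => (Model.not_lt_zero m hm).elim⟩) ?_ _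
  rintro n ⟨a, ha, hmin⟩
  by_cases hn : n ∈ B ∧ pr n a ∈ X
  · refine ⟨n, hn.1, fun m hm hmB => ?_⟩
    rcases Model.lt_succ.1 hm with hm | rfl
    exacts [hXt.trans hn.2 (hmin m hm hmB), hXt.refl m]
  · refine ⟨a, ha, fun m hm hmB => ?_⟩
    rcases Model.lt_succ.1 hm with hm | rfl
    exacts [hmin m hm hmB, (hXt.total a m).resolve_right fun h => hn ⟨hmB, h⟩]

end Minimum

/-! ### Self-embeddings of initial segments -/

section SelfEmbedding

variable {X I F : Set M.carrier} {f : M.carrier → M.carrier} {x z : M.carrier}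

/-- The set `F` is the graph of the function `f` on `A`. -/
def IsGraphOn (A : M.carrier → Prop) (f : M.carrier → M.carrier) (F : Set M.carrier) : Prop :=
  ∀ a b, pr a b ∈ F ↔ A a ∧ b = f a

theorem IsFunction.exists_isGraphOn {A B : M.carrier → Prop} (hF : IsFunction A B F) :
    ∃ f, (∀ a, A a → B (f a)) ∧ IsGraphOn A f F := by
  obtain ⟨hsub, hex, huniq⟩ := hF
  have hmem : ∀ {a b}, pr a b ∈ F → A a ∧ B b := fun h => by
    obtain ⟨a', b', hp, hab⟩ := hsub _ h
    obtain ⟨rfl, rfl⟩ := pr_inj.1 hp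
    exact hab
  have hex' : ∀ a, ∃ b, A a → pr a b ∈ F := fun a => by
    by_cases ha : A a
    exacts [(hex a ha).imp fun b hb _ => hb, ⟨0, fun h => (ha h).elim⟩]
  choose f hf using hex'
  exact ⟨f, fun a ha => (hmem (hf a ha)).2, fun a b =>
    ⟨fun h => ⟨(hmem h).1, huniq _ _ _ ⟨h, hf a (hmem h).1⟩⟩, fun ⟨ha, hb⟩ => hb ▸ hf a ha⟩⟩

theorem exists_isSelfEmbedding (hX : IsTotalOrder X) (hW : ¬ IsWeakWellOrder X) :
    ∃ I ∈ M.sets, ∃ F ∈ M.sets, ∃ f, IsSelfEmbedding X I f ∧ IsGraphOn (· ∈ I) f F ∧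
      (loweredSet X I f).Nonempty := by
  obtain ⟨I, hI, J, -, F, hF, hinI, hinJ, ⟨hJI, hIJ⟩, hfun, hmono⟩ :=
    not_not.1 fun h => hW (isWeakWellOrder_iff.2 ⟨hX.isLinear, h⟩)
  obtain ⟨f, hfJ, hgraph⟩ := hfun.exists_isGraphOn
  push Not at hIJ
  obtain ⟨x, hxI, hxJ⟩ := hIJ
  refine ⟨I, hI, F, hF, f, ⟨fun {a b} hab hb => ?_, fun ha => hJI _ (hfJ _ ha), fun ha hb hab hne =>
    hmono _ _ _ _ ⟨⟨hab, hne⟩, (hgraph _ _).2 ⟨ha, rfl⟩, (hgraph _ _).2 ⟨hb, rfl⟩⟩⟩, hgraph,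
    x, hxI, fun hle => hxJ ?_⟩
  · by_cases hne : a = b
    exacts [hne ▸ hb, hinI.2 a b ⟨⟨hab, hne⟩, hb⟩]
  · by_cases hne : x = f x
    exacts [hne ▸ hfJ x hxI, hinJ.2 x _ ⟨⟨hle, hne⟩, hfJ x hxI⟩]

theorem loweredSet_mem (hX : X ∈ M.sets) (hI : I ∈ M.sets) (hF : F ∈ M.sets)
    (hf : IsGraphOn (· ∈ I) f F) : loweredSet X I f ∈ M.sets := by
  have hex : ∀ z, (∃ y, pr z y ∈ F ∧ pr z y ∉ X) ↔ z ∈ loweredSet X I f := fun z =>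
    ⟨fun ⟨y, hy, hyX⟩ => by obtain ⟨hz, rfl⟩ := (hf z y).1 hy; exact ⟨hz, hyX⟩,
      fun ⟨hz, hzX⟩ => ⟨f z, (hf _ _).2 ⟨hz, rfl⟩, hzX⟩⟩
  have hall : ∀ z, (∀ y, z ∈ I ∧ (pr z y ∈ F → pr z y ∉ X)) ↔ z ∈ loweredSet X I f := fun z =>
    ⟨fun h => ⟨(h 0).1, (h (f z)).2 ((hf _ _).2 ⟨(h 0).1, rfl⟩)⟩,
      fun ⟨hz, hzX⟩ y => ⟨hz, fun hy => ((hf z y).1 hy).2 ▸ hzX⟩⟩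
  simpa only [hex, Set.ofPred_mem_eq] using delta01_comprehension
    (Q := fun y z => pr z y ∈ F ∧ pr z y ∉ X) (R := fun y z => z ∈ I ∧ (pr z y ∈ F → pr z y ∉ X))
    (by fun_prop (disch := assumption)) (by fun_prop (disch := assumption))
    fun z => (hex z).trans (hall z).symm

/-- The element `z` has only boundedly many predecessors. -/
def FiniteBelow (X : Set M.carrier) (z : M.carrier) : Prop := ∃ k, ∀ u, pr u z ∈ X → u ≤ k

/-- The element `z` has only boundedly many successors. -/
def FiniteAbove (X : Set M.carrier) (z : M.carrier) : Prop := ∃ k, ∀ u, pr z u ∈ X → u ≤ k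

theorem FiniteBelow.le (hX : IsTotalOrder X) (hz : FiniteBelow X z) (hx : FiniteAbove X x) :
    pr z x ∈ X := by
  obtain ⟨k, hk⟩ := hz
  obtain ⟨l, hl⟩ := hx
  by_contra h
  have hxz : pr x z ∈ X := (hX.total z x).resolve_left h
  rcases hX.total z (max k l + 1) with hle | hle
  · exact ((le_max_right k l).trans_lt (Order.lt_succ _)).not_ge (hl _ (hX.trans hxz hle))
  · exact ((le_max_left k l).trans_lt (Order.lt_succ _)).not_ge (hk _ hle)

theorem not_finiteBelow_of_mem_loweredSet (hX : X ∈ M.sets) (hXt : IsTotalOrder X)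
    (hf : IsSelfEmbedding X I f) (hD : loweredSet X I f ∈ M.sets) (hz : z ∈ loweredSet X I f) :
    ¬ FiniteBelow X z := by
  rintro ⟨k, hk⟩
  have hB : {u | u ∈ loweredSet X I f ∧ pr u z ∈ X} ∈ M.sets :=
    sigma00_comprehension (by fun_prop (disch := assumption))
  obtain ⟨u, ⟨huD, huz⟩, hmin⟩ :=
    exists_min_of_bounded hB hX hXt ⟨z, hz, hXt.refl z⟩ fun u hu => hk u hu.2
  have hfu : pr (f u) u ∈ X := (hXt.total _ _).resolve_left huD.2
  exact huD.2 (hmin _ ⟨hf.map_mem_loweredSet hXt huD, hXt.trans hfu huz⟩)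

theorem not_finiteAbove_of_notMem_loweredSet (hX : X ∈ M.sets) (hXt : IsTotalOrder X)
    (hf : IsSelfEmbedding X I f) (hD : loweredSet X I f ∈ M.sets) (hx : x ∈ loweredSet X I f)
    (hzx : pr z x ∈ X) (hz : z ∉ loweredSet X I f) : ¬ FiniteAbove X z := by
  rintro ⟨k, hk⟩
  have hB : {u | u ∈ loweredSet X I f ∧ pr z u ∈ X} ∈ M.sets :=
    sigma00_comprehension (by fun_prop (disch := assumption))
  obtain ⟨u, ⟨huD, hzu⟩, hmin⟩ :=
    exists_min_of_bounded hB hX hXt ⟨x, hx, hzx⟩ fun u hu => hk u hu.2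
  have hzI : z ∈ I := hf.mem_of_le hzx hx.1
  have hzf : pr z (f z) ∈ X := by_contra fun h => hz ⟨hzI, h⟩
  have hfzu : pr (f z) (f u) ∈ X := (hf.strict_mono hzI huD.1 hzu fun h => hz (h ▸ huD)).1
  exact huD.2 (hmin _ ⟨hf.map_mem_loweredSet hXt huD, hXt.trans hzf hfzu⟩)

theorem setOf_finiteBelow_mem (hX : X ∈ M.sets) (hXt : IsTotalOrder X)
    (hfin : ∀ z, FiniteBelow X z ∨ FiniteAbove X z) (hW : ¬ IsWeakWellOrder X) :
    {z | FiniteBelow X z} ∈ M.sets := by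
  obtain ⟨I, hI, F, hF, f, hf, hgraph, x, hx⟩ := exists_isSelfEmbedding hXt hW
  have hD := loweredSet_mem hX hI hF hgraph
  suffices ∀ z, FiniteBelow X z ↔ pr z x ∈ X ∧ z ∉ loweredSet X I f by
    simp only [this]
    exact sigma00_comprehension (by fun_prop (disch := assumption))
  have hx_above : FiniteAbove X x :=
    (hfin x).resolve_left (not_finiteBelow_of_mem_loweredSet hX hXt hf hD hx)
  exact fun z => ⟨fun hz => ⟨hz.le hXt hx_above,
      fun hzD => not_finiteBelow_of_mem_loweredSet hX hXt hf hD hzD hz⟩,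
    fun ⟨hzx, hzD⟩ => (hfin z).resolve_right
      (not_finiteAbove_of_notMem_loweredSet hX hXt hf hD hx hzx hzD)⟩

end SelfEmbedding

/-! ### True stages -/

section TrueStages

variable {S : Set M.carrier} {a b c x y : M.carrier}

/-- Stage `a` enumerates `x` into `{x | ∃ w, pr w x ∈ S}`: the number `x` with least witness `w`
is enumerated at stage `pr (w + 1) x`. The shift by one leaves the stages `pr 0 i` idle. -/
def Enumerates (S : Set M.carrier) (a x : M.carrier) : Prop :=
  ∃ w ≤ a, a = pr (w + 1) x ∧ pr w x ∈ S ∧ ∀ w' < w, pr w' x ∉ S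

/-- Stage `a` enumerates some number `x`, and no number below `x` is enumerated at a stage after
`a` up to `b`. -/
def AppearsTrue (S : Set M.carrier) (a b : M.carrier) : Prop :=
  ∃ x ≤ a, Enumerates S a x ∧ ∀ k ≤ b, a < k → ∀ y < x, ¬ Enumerates S k y

/-- Dekker's true stages: no smaller number is enumerated later. -/
def IsTrueStage (S : Set M.carrier) (a : M.carrier) : Prop := ∀ b, AppearsTrue S a b

/-- The order of stages in which `a` lies below the later stages at which it appears to be true,
and above the other later ones. -/
def StageLE (S : Set M.carrier) (a b : M.carrier) : Prop :=
  a = b ∨ a < b ∧ AppearsTrue S a b ∨ b < a ∧ ¬ AppearsTrue S b a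

/-- The set coding the relation `StageLE S`. -/
def stageOrder (S : Set M.carrier) : Set M.carrier :=
  {p | ∃ a ≤ p, ∃ b ≤ p, p = pr a b ∧ StageLE S a b}

namespace Enumerates

theorem le (h : Enumerates S a x) : x ≤ a := by
  obtain ⟨w, -, rfl, -⟩ := h
  exact right_le_pr _ _

theorem number_unique (hx : Enumerates S a x) (hy : Enumerates S a y) : x = y := by
  obtain ⟨w, -, rfl, -⟩ := hx
  obtain ⟨w', -, h, -⟩ := hy
  exact (pr_inj.1 h).2

theorem stage_unique (ha : Enumerates S a x) (hb : Enumerates S b x) : a = b := by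
  obtain ⟨w, -, rfl, hw, hmin⟩ := ha
  obtain ⟨w', -, rfl, hw', hmin'⟩ := hb
  rw [le_antisymm (not_lt.1 fun h => hmin _ h hw') (not_lt.1 fun h => hmin' _ h hw)]

end Enumerates

theorem not_enumerates_pr_zero (i : M.carrier) : ¬ Enumerates S (pr 0 i) x := by
  rintro ⟨w, -, h, -⟩
  exact Model.not_lt_zero w ((Order.lt_succ w).trans_eq (pr_inj.1 h).1.symm)

theorem exists_enumerates_iff (hS : S ∈ M.sets) :
    (∃ a, Enumerates S a x) ↔ ∃ w, pr w x ∈ S := by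
  refine ⟨fun ⟨_, w, _, _, hw, _⟩ => ⟨w, hw⟩, fun ⟨w, hw⟩ => ?_⟩
  obtain ⟨w, ⟨-, hw⟩, hmin⟩ := exists_min_sigma01 (Q := fun _ w => pr w x ∈ S) (m := 0)
    (by fun_prop (disch := assumption)) hw
  exact ⟨pr (w + 1) x, w, le_self_add.trans (left_le_pr _ _), rfl, hw,
    fun w' hlt hw' => (hmin w' 0 hw').not_gt hlt⟩

namespace AppearsTrue

theorem mono (h : AppearsTrue S a c) (hbc : b ≤ c) : AppearsTrue S a b := by
  obtain ⟨x, hx, hax, hmin⟩ := h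
  exact ⟨x, hx, hax, fun k hk => hmin k (hk.trans hbc)⟩

theorem le_of_enumerates (h : AppearsTrue S a c) (hab : a < b) (hbc : b ≤ c)
    (hx : Enumerates S a x) (hy : Enumerates S b y) : x ≤ y := by
  obtain ⟨x', -, hx', hmin⟩ := h
  obtain rfl := hx.number_unique hx'
  exact not_lt.1 fun hlt => hmin b hbc hab y hlt hy

theorem trans (hab : a < b) (h : AppearsTrue S a b) (h' : AppearsTrue S b c) :
    AppearsTrue S a c := by
  obtain ⟨x, hx, hax, hmin⟩ := h
  obtain ⟨y, -, hby, hmin'⟩ := h'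
  have hxy : x ≤ y := not_lt.1 fun hlt => hmin b le_rfl hab y hlt hby
  refine ⟨x, hx, hax, fun k hkc hak z hzx => ?_⟩
  rcases le_or_gt k b with hkb | hbk
  exacts [hmin k hkb hak z hzx, hmin' k hkc hbk z (hzx.trans_le hxy)]

end AppearsTrue

namespace StageLE

theorem antisymm (h : StageLE S a b) (h' : StageLE S b a) : a = b := by
  rcases h with h | ⟨hab, hA⟩ | ⟨hba, hA⟩
  · exact h
  · rcases h' with h' | ⟨hba, -⟩ | ⟨-, hA'⟩
    exacts [h'.symm, (lt_asymm hab hba).elim, (hA' hA).elim]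
  · rcases h' with h' | ⟨-, hA'⟩ | ⟨hab, -⟩
    exacts [h'.symm, (hA hA').elim, (lt_asymm hab hba).elim]

theorem total (a b : M.carrier) : StageLE S a b ∨ StageLE S b a := by
  unfold StageLE
  grind [lt_trichotomy a b]

theorem trans (h : StageLE S a b) (h' : StageLE S b c) : StageLE S a c := by
  rcases h with rfl | ⟨hab, hA⟩ | ⟨hba, hA⟩
  · exact h'
  · rcases h' with rfl | ⟨hbc, hB⟩ | ⟨hcb, hB⟩
    · exact .inr (.inl ⟨hab, hA⟩)
    · exact .inr (.inl ⟨hab.trans hbc, hA.trans hab hB⟩)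
    · rcases lt_trichotomy a c with hac | rfl | hca
      · exact .inr (.inl ⟨hac, hA.mono hcb.le⟩)
      · exact .inl rfl
      · exact .inr (.inr ⟨hca, fun h => hB (h.trans hca hA)⟩)
  · rcases h' with rfl | ⟨hbc, hB⟩ | ⟨hcb, hB⟩
    · exact .inr (.inr ⟨hba, hA⟩)
    · rcases lt_trichotomy a c with hac | rfl | hca
      · exact (hA (hB.mono hac.le)).elim
      · exact (hA hB).elim
      · exact .inr (.inr ⟨hca, fun h => hA (hB.trans hbc h)⟩)
    · exact .inr (.inr ⟨hcb.trans hba, fun h => hB (h.mono hba.le)⟩)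

end StageLE

theorem pr_mem_stageOrder : pr a b ∈ stageOrder S ↔ StageLE S a b := by
  refine ⟨?_, fun h => ⟨a, left_le_pr a b, b, right_le_pr a b, rfl, h⟩⟩
  rintro ⟨a', -, b', -, hp, h⟩
  obtain ⟨rfl, rfl⟩ := pr_inj.1 hp
  exact h

theorem isTotalOrder_stageOrder : IsTotalOrder (stageOrder S) where
  antisymm h h' := (pr_mem_stageOrder.1 h).antisymm (pr_mem_stageOrder.1 h')
  trans h h' := pr_mem_stageOrder.2 ((pr_mem_stageOrder.1 h).trans (pr_mem_stageOrder.1 h'))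
  total a b := (StageLE.total a b).imp pr_mem_stageOrder.2 pr_mem_stageOrder.2

@[fun_prop]
theorem Sigma00Def.enumerates {n : ℕ} (hS : S ∈ M.sets) (i j : Fin n) :
    Sigma00Def fun v => Enumerates S (v i) (v j) := by
  unfold Enumerates
  fun_prop (disch := assumption)

theorem stageOrder_mem (hS : S ∈ M.sets) : stageOrder S ∈ M.sets := by
  refine sigma00_comprehension ?_
  unfold StageLE AppearsTrue
  fun_prop (disch := assumption)

theorem not_isWellOrder_stageOrder : ¬ IsWellOrder (stageOrder S) := by
  let F : Set M.carrier := {p | ∃ i ≤ p, p = pr i (pr 0 i)}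
  have mem_F : ∀ i b, pr i b ∈ F ↔ b = pr 0 i := fun i b =>
    ⟨fun ⟨j, _, hp⟩ => by obtain ⟨rfl, rfl⟩ := pr_inj.1 hp; rfl,
      fun hb => hb ▸ ⟨i, left_le_pr _ _, rfl⟩⟩
  have hF : F ∈ M.sets := sigma00_comprehension (by fun_prop)
  rw [isWellOrder_iff]
  refine fun ⟨_, hdesc⟩ => hdesc ⟨F, hF, ⟨fun p ⟨i, _, hp⟩ =>
    ⟨i, pr 0 i, hp, rfl, isTotalOrder_stageOrder.refl _⟩, fun i _ => ⟨pr 0 i, (mem_F i _).2 rfl⟩,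
    fun i b c ⟨hb, hc⟩ => ((mem_F i b).1 hb).trans ((mem_F i c).1 hc).symm⟩,
    fun i b c ⟨hb, hc⟩ => ?_⟩
  obtain rfl := (mem_F i b).1 hb
  obtain rfl := (mem_F (i + 1) c).1 hc
  have hlt : pr 0 i < pr 0 (i + 1) := pr_lt_pr_of_add_lt_add (by simp)
  have hidle : ¬ AppearsTrue S (pr 0 i) (pr 0 (i + 1)) :=
    fun ⟨_, _, h, _⟩ => not_enumerates_pr_zero i h
  exact ⟨pr_mem_stageOrder.2 (.inr (.inr ⟨hlt, hidle⟩)), hlt.ne'⟩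

theorem finiteBelow_stageOrder_iff : FiniteBelow (stageOrder S) a ↔ IsTrueStage S a := by
  simp only [FiniteBelow, pr_mem_stageOrder]
  refine ⟨fun ⟨k, hk⟩ b => ?_, fun ha => ⟨a, fun u hu => ?_⟩⟩
  · by_contra hb
    obtain ⟨u, hu⟩ := exists_gt (max a (max b k))
    simp only [max_lt_iff] at hu
    exact hu.2.2.not_ge (hk u (.inr (.inr ⟨hu.1, fun h => hb (h.mono hu.2.1.le)⟩)))
  · rcases hu with rfl | ⟨hua, -⟩ | ⟨-, hu⟩
    exacts [le_rfl, hua.le, (hu (ha u)).elim]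

theorem finiteAbove_stageOrder (ha : ¬ IsTrueStage S a) : FiniteAbove (stageOrder S) a := by
  obtain ⟨b, hb⟩ := not_forall.1 ha
  refine ⟨max a b, fun u hu => ?_⟩
  rcases pr_mem_stageOrder.1 hu with rfl | ⟨-, hu⟩ | ⟨hua, -⟩
  · exact le_max_left _ _
  · exact le_max_of_le_right (le_of_not_ge fun hbu => hb (hu.mono hbu))
  · exact le_max_of_le_left hua.le

theorem setOf_isTrueStage_mem (hW : M.Satisfies weakWellOrdersAreWellOrders) (hS : S ∈ M.sets) :
    {a | IsTrueStage S a} ∈ M.sets := by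
  have hX := stageOrder_mem hS
  simpa only [finiteBelow_stageOrder_iff] using setOf_finiteBelow_mem hX isTotalOrder_stageOrder
    (fun a => (em (IsTrueStage S a)).imp finiteBelow_stageOrder_iff.2 finiteAbove_stageOrder)
    fun h => not_isWellOrder_stageOrder (hW _ hX h)

theorem IsTrueStage.exists_enumerates_iff (ha : IsTrueStage S a) (hy : Enumerates S a y)
    (hxy : x < y) : (∃ b, Enumerates S b x) ↔ ∃ b ≤ a, Enumerates S b x := by
  refine ⟨fun ⟨b, hb⟩ => ⟨b, not_lt.1 fun hab => ?_, hb⟩, fun ⟨b, _, hb⟩ => ⟨b, hb⟩⟩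
  exact hxy.not_ge ((ha b).le_of_enumerates hab le_rfl hy hb)

theorem exists_isTrueStage_ge (hS : S ∈ M.sets) (hunb : ∀ N, ∃ a ≥ N, ∃ x, Enumerates S a x)
    (N : M.carrier) : ∃ a ≥ N, IsTrueStage S a := by
  obtain ⟨a, haN, x, hx⟩ := hunb N
  obtain ⟨x, ⟨a, haN, hx⟩, hmin⟩ := exists_min_sigma01
    (Q := fun a x => N ≤ a ∧ Enumerates S a x) (by fun_prop (disch := assumption)) ⟨haN, hx⟩
  exact ⟨a, haN, fun b => ⟨x, hx.le, hx, fun k _ hak y hyx hy =>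
    hyx.not_ge (hmin y k ⟨haN.trans hak.le, hy⟩)⟩⟩

theorem exists_isTrueStage_enumerates_ge (hW : M.Satisfies weakWellOrdersAreWellOrders)
    (hS : S ∈ M.sets) (hunb : ∀ N, ∃ a ≥ N, ∃ x, Enumerates S a x) (n : M.carrier) :
    ∃ a, IsTrueStage S a ∧ ∃ y ≤ a, Enumerates S a y ∧ n ≤ y := by
  have hT := setOf_isTrueStage_mem hW hS
  refine sigma01_induction
    (Q := fun a n => a ∈ {a | IsTrueStage S a} ∧ ∃ y ≤ a, Enumerates S a y ∧ n ≤ y)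
    (by fun_prop (disch := assumption)) ?_ ?_ n
  · obtain ⟨a, -, ha⟩ := exists_isTrueStage_ge hS hunb 0
    obtain ⟨y, hya, hy, -⟩ := ha a
    exact ⟨a, ha, y, hya, hy, zero_le⟩
  · rintro n ⟨a, ha, y, -, hy, hny⟩
    obtain ⟨b, hab, hb⟩ := exists_isTrueStage_ge hS hunb (a + 1)
    obtain ⟨z, hzb, hz, -⟩ := hb b
    rw [ge_iff_le, Order.add_one_le_iff] at hab
    have hyz : y ≠ z := by rintro rfl; exact hab.ne (hy.stage_unique hz)
    have hlt : y < z := ((ha b).le_of_enumerates hab le_rfl hy hz).lt_of_ne hyz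
    exact ⟨b, hb, z, hzb, hz, Order.add_one_le_iff.2 (hny.trans_lt hlt)⟩

theorem range_mem_of_unbounded (hW : M.Satisfies weakWellOrdersAreWellOrders) (hS : S ∈ M.sets)
    (hunb : ∀ N, ∃ a ≥ N, ∃ x, Enumerates S a x) : {x | ∃ a, Enumerates S a x} ∈ M.sets := by
  set T := {a | IsTrueStage S a}
  have hT : T ∈ M.sets := setOf_isTrueStage_mem hW hS
  have hlarge : ∀ x, ∃ a ∈ T, ∃ y ≤ a, Enumerates S a y ∧ x < y := by
    simp only [← Order.add_one_le_iff]
    exact fun x => exists_isTrueStage_enumerates_ge hW hS hunb (x + 1)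
  have hdecide : ∀ {a x}, a ∈ T → (∃ y ≤ a, Enumerates S a y ∧ x < y) →
      ((∃ b, Enumerates S b x) ↔ ∃ b ≤ a, Enumerates S b x) :=
    fun ha ⟨_, _, hy, hxy⟩ => ha.exists_enumerates_iff hy hxy
  have hex : ∀ x, (∃ a, (a ∈ T ∧ ∃ y ≤ a, Enumerates S a y ∧ x < y) ∧ ∃ b ≤ a, Enumerates S b x) ↔
      ∃ b, Enumerates S b x := fun x =>
    ⟨fun ⟨_, _, b, _, hb⟩ => ⟨b, hb⟩, fun h => (hlarge x).imp fun a ⟨ha, hy⟩ =>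
      ⟨⟨ha, hy⟩, (hdecide ha hy).1 h⟩⟩
  have hall : ∀ x, (∀ a, (a ∈ T ∧ ∃ y ≤ a, Enumerates S a y ∧ x < y) → ∃ b ≤ a, Enumerates S b x) ↔
      ∃ b, Enumerates S b x := fun x =>
    ⟨fun h => (hlarge x).elim fun a ha => (hdecide ha.1 ha.2).2 (h a ha),
      fun h a ha => (hdecide ha.1 ha.2).1 h⟩
  simpa only [hex] using delta01_comprehension
    (Q := fun a x => (a ∈ T ∧ ∃ y ≤ a, Enumerates S a y ∧ x < y) ∧ ∃ b ≤ a, Enumerates S b x)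
    (R := fun a x => (a ∈ T ∧ ∃ y ≤ a, Enumerates S a y ∧ x < y) → ∃ b ≤ a, Enumerates S b x)
    (by fun_prop (disch := assumption)) (by fun_prop (disch := assumption))
    fun x => (hex x).trans (hall x).symm

theorem projection_mem (hW : M.Satisfies weakWellOrdersAreWellOrders) (hS : S ∈ M.sets) :
    {x | ∃ w, pr w x ∈ S} ∈ M.sets := by
  simp only [← exists_enumerates_iff hS]
  by_cases hunb : ∀ N, ∃ a ≥ N, ∃ x, Enumerates S a x
  · exact range_mem_of_unbounded hW hS hunb
  · push Not at hunb
    obtain ⟨N, hN⟩ := hunb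
    have hbound : ∀ x, (∃ a, Enumerates S a x) ↔ ∃ a < N, Enumerates S a x := fun x =>
      ⟨fun ⟨a, ha⟩ => ⟨a, not_le.1 fun h => hN a h x ha, ha⟩, fun ⟨a, _, ha⟩ => ⟨a, ha⟩⟩
    simp only [hbound]
    exact sigma00_comprehension (by fun_prop (disch := assumption))

end TrueStages

/-! ### Arithmetical comprehension -/

section ArithmeticalComprehension

variable {n k : ℕ}

theorem tuple_injective : Function.Injective (tuple (M := M) (n := n)) := by
  induction n with
  | zero => exact fun v w _ => Subsingleton.elim v w
  | succ n ih =>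
    intro v w h
    obtain ⟨hhead, htail⟩ := pr_inj.1 h
    exact funext (Fin.cases hhead (congrFun (ih htail)))

theorem le_tuple (v : Fin n → M.carrier) (i : Fin n) : v i ≤ tuple v := by
  induction n with
  | zero => exact i.elim0
  | succ n ih =>
    cases i using Fin.cases with
    | zero => exact left_le_pr _ _
    | succ i => exact (ih (fun i => v i.succ) i).trans (right_le_pr _ _)

theorem Sigma00Def.bex_tuple {P : M.carrier → (Fin n → M.carrier) → Prop}
    (hP : Sigma00Def fun v : Fin (n + 1) → M.carrier => P (v (Fin.last n)) fun i => v i.castSucc) :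
    Sigma00Def fun x : Fin 1 → M.carrier => ∃ v : Fin n → M.carrier, (∀ i, v i ≤ x 0) ∧
      P (x 0) v := by
  induction n with
  | zero => simpa [Subsingleton.elim _ (Fin.elim0 : Fin 0 → M.carrier)] using hP
  | succ n ih =>
    have cons_castSucc (v : Fin (n + 2) → M.carrier) :
        (Fin.cons (v 0) fun i => v i.castSucc.succ : Fin (n + 1) → M.carrier) =
          fun i => v i.castSucc := funext (Fin.cases rfl fun _ => rfl)
    have := ih (P := fun c u => ∃ a ≤ c, P c (Fin.cons a u))
      (.bex_le (.var _) (by simpa only [cons_castSucc, Fin.succ_last] using hP))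
    convert this using 2 with x
    simp only [Fin.exists_fin_succ_pi, Fin.forall_fin_succ, Fin.cons_zero, Fin.cons_succ]
    tauto

theorem Sigma00Def.ex (hW : M.Satisfies weakWellOrdersAreWellOrders)
    {R : M.carrier → (Fin n → M.carrier) → Prop}
    (hR : Sigma00Def fun v : Fin (n + 1) → M.carrier => R (v 0) fun i => v i.succ) :
    Sigma00Def fun v => ∃ a, R a v := by
  let S : Set M.carrier :=
    {p | ∃ v : Fin (n + 1) → M.carrier, (∀ i, v i ≤ p) ∧ p = tuple v ∧ R (v 0) fun i => v i.succ}
  have hS : S ∈ M.sets := sigma00_comprehension <| .bex_tuple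
      (P := fun p v => p = tuple v ∧ R (v 0) fun i => v i.succ) <|
    .and (.eq (.var _) (.tuple Fin.castSucc)) (hR.rename Fin.castSucc)
  have mem_S : ∀ a v, pr a (tuple v) ∈ S ↔ R a v := fun a v =>
    ⟨fun ⟨w, _, hw, h⟩ => by
      obtain rfl : Fin.cons a v = w := tuple_injective hw
      exact h,
    fun h => ⟨Fin.cons a v, le_tuple (Fin.cons a v : Fin (n + 1) → M.carrier), rfl, h⟩⟩
  simpa only [Set.mem_ofPred_eq, mem_S, id] using
    Sigma00Def.mem (projection_mem hW hS) (.tuple (n := n) id)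

theorem sigma00Def_sat (hW : M.Satisfies weakWellOrdersAreWellOrders) {φ : Formula n k}
    (hφ : φ.IsArithmetical) {V : Fin k → Set M.carrier} (hV : ∀ i, V i ∈ M.sets) :
    Sigma00Def fun v => M.Sat v V φ := by
  induction hφ with
  | eq s t => exact .eq (.val s) (.val t)
  | lt s t => exact .lt (.val s) (.val t)
  | mem t X => exact .mem (hV X) (.val t)
  | not _ ih => exact (ih hV).not
  | and _ _ ih₁ ih₂ => exact (ih₁ hV).and (ih₂ hV)
  | or _ _ ih₁ ih₂ => exact (ih₁ hV).or (ih₂ hV)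
  | imp _ _ ih₁ ih₂ => exact (ih₁ hV).imp (ih₂ hV)
  | @all _ _ φ _ ih =>
    simpa only [Sat, not_exists, not_not] using
      (Sigma00Def.ex hW (R := fun a v => ¬ M.Sat (Fin.cons a v) V φ)
        (by simpa only [← Fin.tail_def, Fin.cons_self_tail] using (ih hV).not)).not
  | ex _ ih =>
    exact Sigma00Def.ex hW (by simpa only [← Fin.tail_def, Fin.cons_self_tail] using ih hV)

theorem satisfies_arithmeticalComprehension (hW : M.Satisfies weakWellOrdersAreWellOrders)
    {φ : Sentence} (hφ : φ ∈ ArithmeticalComprehension) : M.Satisfies φ := by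
  obtain ⟨hφ⟩ := hφ
  refine (satisfies_close _).2 fun V hV v => ?_
  refine ⟨_, sigma00_comprehension (Q := fun x => M.Sat (Fin.cons x v) V _)
    ((sigma00Def_sat hW hφ hV).cons_const v), fun x => ?_⟩
  simp only [Formula.iff, Sat, sat_subst, Fin.cons_succ]
  exact ⟨id, id⟩

end ArithmeticalComprehension

end Model

end SOA

theorem mainTheorem9 (φ : SOA.Sentence) (hφ : φ ∈ SOA.ArithmeticalComprehension) :
    SOA.Entails.{u} (SOA.RCA0 ∪ {SOA.weakWellOrdersAreWellOrders}) φ := by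
  intro M hM
  have : M.IsRCA0 := ⟨fun ψ hψ => hM ψ (.inl hψ)⟩
  exact SOA.Model.satisfies_arithmeticalComprehension (hM _ (.inr rfl)) hφ
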